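/- Let $n\ge 2$, $d>0$, let $A=\mathbf 1\mathbf 1^{\top}-I_n$ be the adjacency matrix of the complete graph on $n$ nodes, and consider the opinion dynamics $\dot x=\Phi(x,u):=-dx+uA\tanh(x)$ on $\mathbb R^n$ ($\tanh$ componentwise) with parameter $u\in\mathbb R$. Put $x^\star=0$, $u^\star=\frac{d}{n-1}$, $J^\star=D_x\Phi(x^\star,u^\star)$. Lyapunov–Schmidt bounds. Let $q=\dim\ker J^\star$, let $V\in\mathbb R^{n\times q}$ and $\bar V,W\in\mathbb R^{n\times(n-q)}$ have orthonormal columns spanning $\ker J^\star$, $(\ker J^\star)^\perp$ and $\operatorname{range}J^\star$, and write $\Gamma(\alpha,\beta)=V\alpha+\bar V\beta$, $\alpha_0=V^\top x^\star$, $\beta_0=\bar V^\top x^\star$. With spectral norms and Euclidean open balls put $$M_\parallel=\big\|[\,0\;\;W^\top D_u\Phi(x^\star,u^\star)]\big\|,\qquad M_\perp=\big\|(W^\top J^\star\bar V)^{-1}\big\|,$$ $$L_\parallel=\sup\big\|W^\top\big[D_x\Phi(\Gamma(\alpha,\beta_0),u)V\;\;\; D_u\Phi(\Gamma(\alpha,\beta_0),u)-D_u\Phi(x^\star,u^\star)\big]\big\|,$$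 $$L_\perp=\sup\big\|W^\top\big(D_x\Phi(\Gamma(\alpha,\beta),u)-J^\star\big)\bar V\big\|,$$ the suprema being over $(\alpha,u)\in B((\alpha_0,u^\star),R_\parallel)$ and, for $L_\perp$, also $\beta\in B(\beta_0,R_\perp)$. Radii $R_\parallel,R_\perp>0$ are *within the bounds of validity* of the reduction at $(x^\star,u^\star)$ if $L_\parallel,L_\perp<\infty$ and $$L_\parallel R_\parallel+L_\perp R_\perp<\frac{R_\perp}{M_\perp}-M_\parallel R_\parallel,\qquad M_\perp L_\perp<1 .$$ Claim. The complete graph is $(n-1)$-regular, and its adjacency eigenvalues are $\lambda_1(A)=n-1$ and $\lambda_j(A)=-1$ for $2\le j\le n$. Hence the bound $\frac{d(k-\lambda_2(A))}{k\max\{|\lambda_2(A)|,|\lambda_n(A)|\}}$ for $k$-regular graphs (here $k=n-1$) equals $n\,u^\star=\frac{dn}{n-1}$. The point $(0,u^\star)$ is a singular equilibrium, with $\Phi(0,u^\star)=0$ and $\ker J^\star=\operatorname{span}\{\mathbf 1_n\}$, so $q=1$. For every choice of $V,\bar V,W$, the radii $R_\parallel,R_\perp$ are within the bounds of validity if and only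 if $$0<R_\parallel<n\,u^\star=\frac{dn}{n-1}\qquad\text{and}\qquad R_\perp>0$$ (that is, $0<R_\parallel<n$ and $R_\perp>0$ when $d=n-1$, i.e. $u^\star=1$). For all such radii there is a smooth map $\varphi:B((\alpha_0,u^\star),R_\parallel)\to B(\beta_0,R_\perp)$ with $\varphi(\alpha_0,u^\star)=\beta_0$ such that, for $(\alpha,u)$ and $\beta$ in these balls, $W^\top\Phi(\Gamma(\alpha,\beta),u)=0$ if and only if $\beta=\varphi(\alpha,u)$. -/

import Mathlib

open scoped ContDiff

noncomputable section

namespace LyapunovSchmidt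

/-- `ℝⁿ` with the Euclidean norm. -/
abbrev E (n : ℕ) := EuclideanSpace ℝ (Fin n)

/-- The partial derivative `D_x Φ(x, p)`. -/
def Dx {n : ℕ} (Φ : E n → ℝ → E n) (x : E n) (p : ℝ) : E n →L[ℝ] E n :=
  fderiv ℝ (fun y => Φ y p) x

/-- The partial derivative `D_p Φ(x, p)`. -/
def Dp {n : ℕ} (Φ : E n → ℝ → E n) (x : E n) (p : ℝ) : ℝ →L[ℝ] E n :=
  fderiv ℝ (fun v => Φ x v) p

/-- Matrices `V`, `V̄`, `W` with orthonormal columns whose images are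
`ker J`, `(ker J)ᗮ` and `range J`, viewed as linear isometric embeddings. -/
structure Frame {n : ℕ} (J : E n →L[ℝ] E n) (q r : ℕ) where
  V : E q →ₗᵢ[ℝ] E n
  Vbar : E r →ₗᵢ[ℝ] E n
  W : E r →ₗᵢ[ℝ] E n
  range_V : LinearMap.range V.toLinearMap = LinearMap.ker J.toLinearMap
  range_Vbar : LinearMap.range Vbar.toLinearMap = (LinearMap.ker J.toLinearMap)ᗮ
  range_W : LinearMap.range W.toLinearMap = LinearMap.range J.toLinearMap

namespace Frame

variable {n q r : ℕ} {J : E n →L[ℝ] E n} (F : Frame J q r)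

/-- `Vᵀ`. -/
def Vt : E n →L[ℝ] E q := ContinuousLinearMap.adjoint F.V.toContinuousLinearMap

/-- `V̄ᵀ`. -/
def VbarT : E n →L[ℝ] E r := ContinuousLinearMap.adjoint F.Vbar.toContinuousLinearMap

/-- `Wᵀ`. -/
def Wt : E n →L[ℝ] E r := ContinuousLinearMap.adjoint F.W.toContinuousLinearMap

/-- `Γ(α, β) = V α + V̄ β`. -/
def Γ (a : E q) (b : E r) : E n := F.V a + F.Vbar b

/-- The open ball around `(α₀, p⋆)`, `α₀ = Vᵀ x⋆`, in the Euclidean norm of `ℝ^q × ℝ`. -/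
def ballPar (xs : E n) (ps R : ℝ) : Set (WithLp 2 (E q × ℝ)) :=
  Metric.ball (WithLp.toLp 2 (F.Vt xs, ps)) R

/-- The open ball around `β₀ = V̄ᵀ x⋆`. -/
def ballPerp (xs : E n) (R : ℝ) : Set (E r) := Metric.ball (F.VbarT xs) R

variable (Φ : E n → ℝ → E n) (xs : E n) (ps : ℝ)

/-- `M_∥ = ‖[0, Wᵀ D_p Φ(x⋆, p⋆)]‖`. -/
def Mpar : ℝ :=
  ‖(F.Wt ∘L Dp Φ xs ps ∘L WithLp.sndL 2 ℝ (E q) ℝ : WithLp 2 (E q × ℝ) →L[ℝ] E r)‖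

/-- `M_⊥ = ‖(Wᵀ D_x Φ(x⋆, p⋆) V̄)⁻¹‖`. -/
def Mperp : ℝ :=
  ‖ContinuousLinearMap.inverse (F.Wt ∘L Dx Φ xs ps ∘L F.Vbar.toContinuousLinearMap)‖

/-- `ξ_∥(α, p) = Wᵀ [D_x Φ(Γ(α, β₀), p) V, D_p Φ(Γ(α, β₀), p) - D_p Φ(x⋆, p⋆)]`. -/
def xiPar (a : E q) (p : ℝ) : WithLp 2 (E q × ℝ) →L[ℝ] E r :=
  F.Wt ∘L
    (Dx Φ (F.Γ a (F.VbarT xs)) p ∘L F.V.toContinuousLinearMap ∘L WithLp.fstL 2 ℝ (E q) ℝ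
      + (Dp Φ (F.Γ a (F.VbarT xs)) p - Dp Φ xs ps) ∘L WithLp.sndL 2 ℝ (E q) ℝ)

/-- `ξ_⊥(α, β, p) = Wᵀ (D_x Φ(Γ(α, β), p) - D_x Φ(x⋆, p⋆)) V̄`. -/
def xiPerp (a : E q) (b : E r) (p : ℝ) : E r →L[ℝ] E r :=
  F.Wt ∘L (Dx Φ (F.Γ a b) p - Dx Φ xs ps) ∘L F.Vbar.toContinuousLinearMap

/-- The set of norms whose supremum is `L_∥`. -/
def normsPar (Rpar : ℝ) : Set ℝ :=
  {t | ∃ z ∈ F.ballPar xs ps Rpar, t = ‖F.xiPar Φ xs ps z.fst z.snd‖}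

/-- The set of norms whose supremum is `L_⊥`. -/
def normsPerp (Rpar Rperp : ℝ) : Set ℝ :=
  {t | ∃ z ∈ F.ballPar xs ps Rpar, ∃ b ∈ F.ballPerp xs Rperp,
    t = ‖F.xiPerp Φ xs ps z.fst b z.snd‖}

/-- `L_∥`. -/
def Lpar (Rpar : ℝ) : ℝ := sSup (F.normsPar Φ xs ps Rpar)

/-- `L_⊥`. -/
def Lperp (Rpar Rperp : ℝ) : ℝ := sSup (F.normsPerp Φ xs ps Rpar Rperp)

/-- The bounds of validity of the Lyapunov–Schmidt reduction at `(x⋆, p⋆)`: both radii are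
positive, the suprema `L_∥`, `L_⊥` are finite, and
`L_∥ R_∥ + L_⊥ R_⊥ < R_⊥ / M_⊥ - M_∥ R_∥`, `M_⊥ L_⊥ < 1`. -/
structure WithinBounds (Rpar Rperp : ℝ) : Prop where
  par_pos : 0 < Rpar
  perp_pos : 0 < Rperp
  bdd_par : BddAbove (F.normsPar Φ xs ps Rpar)
  bdd_perp : BddAbove (F.normsPerp Φ xs ps Rpar Rperp)
  main : F.Lpar Φ xs ps Rpar * Rpar + F.Lperp Φ xs ps Rpar Rperp * Rperp
    < Rperp / F.Mperp Φ xs ps - F.Mpar Φ xs ps * Rpar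
  contraction : F.Mperp Φ xs ps * F.Lperp Φ xs ps Rpar Rperp < 1

/-- `φ` is the smooth implicit map `B((α₀, p⋆), R_∥) → B(β₀, R_⊥)` of the reduction:
`φ(α₀, p⋆) = β₀`, and within the two balls `Wᵀ Φ(Γ(α, β), p) = 0` holds exactly for
`β = φ(α, p)`. -/
structure IsImplicitMap (Rpar Rperp : ℝ) (φ : WithLp 2 (E q × ℝ) → E r) : Prop where
  mapsTo : Set.MapsTo φ (F.ballPar xs ps Rpar) (F.ballPerp xs Rperp)
  smooth : ContDiffOn ℝ ∞ φ (F.ballPar xs ps Rpar)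
  base : φ (WithLp.toLp 2 (F.Vt xs, ps)) = F.VbarT xs
  solves : ∀ z ∈ F.ballPar xs ps Rpar, ∀ b ∈ F.ballPerp xs Rperp,
    F.Wt (Φ (F.Γ z.fst b) z.snd) = 0 ↔ b = φ z

end Frame

section Graph

variable {n : ℕ} (G : SimpleGraph (Fin n)) [DecidableRel G.Adj]

/-- The opinion dynamics `Φ(x, u) = -d x + u A tanh(x)` over a graph with adjacency matrix `A`. -/
def opinionField (d : ℝ) (x : E n) (u : ℝ) : E n :=
  -(d • x) + u • WithLp.toLp 2 ((G.adjMatrix ℝ).mulVec fun i => Real.tanh (x i))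

/-- The adjacency eigenvalues `λ_1 ≥ ⋯ ≥ λ_n`, with multiplicity; `adjEig G j` is `λ_{j+1}`. -/
def adjEig (j : Fin n) : ℝ :=
  (G.isHermitian_adjMatrix ℝ).eigenvalues₀ (Fin.cast (Fintype.card_fin n).symm j)

/-- The bound `d (k - λ_2) / (k |λ'|)`, `|λ'| = max (|λ_2|, |λ_n|)`, for a `k`-regular graph
on `n ≥ 2` nodes. -/
def regularBound (hn : 2 ≤ n) (d : ℝ) (k : ℕ) : ℝ :=
  d * (k - adjEig G ⟨1, by omega⟩) /
    (k * max |adjEig G ⟨1, by omega⟩| |adjEig G ⟨n - 1, by omega⟩|)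

end Graph

end LyapunovSchmidt

end

/-! The range of `J⋆` is the orthogonal complement of `𝟏`, so `Wᵀ` kills exactly the constant
vectors. Since `A = 𝟏𝟏ᵀ - I`, the coupling sum is constant and disappears under `Wᵀ`, leaving the
decoupled coordinates `-(d xᵢ + u tanh xᵢ)`. The consensus line is invariant, hence `M_∥ = L_∥ = 0`;
on `𝟏ᗮ`, `J⋆` is the scalar `-n u⋆`, hence `M_⊥ = 1/(n u⋆)`. Both validity inequalities thus say
`L_⊥ < n u⋆`. Now `ξ_⊥` is a compressed diagonal matrix (`xiPerp_apply`), which gives `R_∥ ≤ L_⊥ ≤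
max u⋆ R_∥`; as `u⋆ < n u⋆`, the condition is `R_∥ < n u⋆` (`withinBounds_iff`). For such radii `u >
-d`, so `t ↦ d t + u tanh t` is injective and the reduced equation forces consensus: `φ = 0`. -/

namespace LyapunovSchmidt

/-! ### Spectrum of the complete graph and the regular-graph bound. -/

section CompleteGraph

theorem hasDerivAt_tanh (t : ℝ) : HasDerivAt Real.tanh (1 - Real.tanh t ^ 2) t := by
  have h := (Real.hasDerivAt_sinh t).div (Real.hasDerivAt_cosh t) (Real.cosh_pos t).ne'
  have e : Real.tanh = Real.sinh / Real.cosh := by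
    funext s
    simp [Real.tanh_eq_sinh_div_cosh]
  rw [e]
  refine h.congr_deriv ?_
  have := (Real.cosh_pos t).ne'
  simp only [Pi.div_apply]
  field_simp

theorem mulVec_adjMatrix_top {n : ℕ} (v : Fin n → ℝ) (i : Fin n) :
    (((⊤ : SimpleGraph (Fin n)).adjMatrix ℝ).mulVec v) i = ∑ j, v j - v i := by
  rw [SimpleGraph.adjMatrix_mulVec_apply, SimpleGraph.neighborFinset_eq_filter]
  have h : Finset.univ.filter ((⊤ : SimpleGraph (Fin n)).Adj i) = Finset.univ.erase i := by
    ext j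
    simp [eq_comm]
  rw [h, ← Finset.add_sum_erase Finset.univ v (Finset.mem_univ i)]
  ring

theorem opinionField_top_apply {n : ℕ} (d : ℝ) (x : E n) (u : ℝ) (i : Fin n) :
    opinionField (⊤ : SimpleGraph (Fin n)) d x u i
      = -(d * x i) + u * (∑ j, Real.tanh (x j) - Real.tanh (x i)) := by
  rw [← mulVec_adjMatrix_top fun j => Real.tanh (x j)]
  rfl

theorem eigenvalue_adjMatrix_top {n : ℕ} {μ : ℝ} {v : Fin n → ℝ} (hv : v ≠ 0)
    (h : ((⊤ : SimpleGraph (Fin n)).adjMatrix ℝ).mulVec v = μ • v) :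
    μ = n - 1 ∨ μ = -1 := by
  have hi : ∀ i, ∑ j, v j = (μ + 1) * v i := fun i => by
    have := congrFun h i
    rw [mulVec_adjMatrix_top] at this
    simp only [Pi.smul_apply, smul_eq_mul] at this
    linarith
  have hs : (n : ℝ) * ∑ j, v j = (μ + 1) * ∑ j, v j := by
    conv_rhs => rw [Finset.mul_sum]
    rw [← Finset.sum_congr rfl fun i _ => hi i]
    simp
  by_cases hS : ∑ j, v j = 0
  · right
    obtain ⟨i, hvi⟩ := Function.ne_iff.mp hv
    have := hi i
    rw [hS, eq_comm, mul_eq_zero] at this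
    rcases this with h | h
    · linarith
    · exact absurd h hvi
  · left
    have := mul_right_cancel₀ hS hs
    linarith

theorem adjEig_eq_eigenvalues {n : ℕ} (G : SimpleGraph (Fin n)) [DecidableRel G.Adj] :
    ∃ e : Fin n ≃ Fin n, ∀ j, adjEig G j = (G.isHermitian_adjMatrix ℝ).eigenvalues (e j) := by
  refine ⟨(finCongr (Fintype.card_fin n).symm).trans
    (Fintype.equivOfCardEq (Fintype.card_fin _)), fun j => ?_⟩
  simp [adjEig, Matrix.IsHermitian.eigenvalues]

theorem adjEig_antitone {n : ℕ} (G : SimpleGraph (Fin n)) [DecidableRel G.Adj] :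
    Antitone (adjEig G) := fun _ _ h =>
  (G.isHermitian_adjMatrix ℝ).eigenvalues₀_antitone h

theorem sum_adjEig {n : ℕ} (G : SimpleGraph (Fin n)) [DecidableRel G.Adj] :
    ∑ j, adjEig G j = 0 := by
  obtain ⟨e, he⟩ := adjEig_eq_eigenvalues G
  have h := (G.isHermitian_adjMatrix ℝ).trace_eq_sum_eigenvalues
  rw [SimpleGraph.trace_adjMatrix] at h
  simp_rw [he]
  rw [e.sum_comp]
  exact h.symm

theorem adjEig_top_mem {n : ℕ} (j : Fin n) :
    adjEig (⊤ : SimpleGraph (Fin n)) j = n - 1 ∨ adjEig (⊤ : SimpleGraph (Fin n)) j = -1 := by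
  obtain ⟨e, he⟩ := adjEig_eq_eigenvalues (⊤ : SimpleGraph (Fin n))
  rw [he]
  have hA := (⊤ : SimpleGraph (Fin n)).isHermitian_adjMatrix ℝ
  refine eigenvalue_adjMatrix_top ?_ (hA.mulVec_eigenvectorBasis (e j))
  intro h
  apply hA.eigenvectorBasis.toBasis.ne_zero (e j)
  ext i
  simpa using congrFun h i

/-- The multiplicities follow from the ordering, the two admissible values and the vanishing trace.
-/
theorem adjEig_top {n : ℕ} (hn : 2 ≤ n) (j : Fin n) :
    adjEig (⊤ : SimpleGraph (Fin n)) j = if j.val = 0 then (n : ℝ) - 1 else -1 := by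
  set f := adjEig (⊤ : SimpleGraph (Fin n)) with hf
  have hn' : (2 : ℝ) ≤ n := by exact_mod_cast hn
  have hge : ∀ j, -1 ≤ f j := fun j => by
    rcases adjEig_top_mem j with h | h <;> rw [hf, h]
    linarith
  let i0 : Fin n := ⟨0, by omega⟩
  have hsum : f i0 + ∑ j ∈ Finset.univ.erase i0, f j = 0 := by
    rw [Finset.add_sum_erase _ _ (Finset.mem_univ i0)]
    exact sum_adjEig _
  have hcard : ((Finset.univ.erase i0).card : ℝ) = n - 1 := by
    rw [Finset.card_erase_of_mem (Finset.mem_univ i0), Finset.card_univ, Fintype.card_fin,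
      Nat.cast_sub (by omega)]
    simp
  have hne : ∀ j, j ≠ i0 → f j = -1 := by
    intro j hj
    rcases adjEig_top_mem j with h | h
    · exfalso
      -- A second eigenvalue `n - 1` would make the trace positive, the remaining ones being at
      -- least `-1`.
      have h0 : (n : ℝ) - 1 ≤ f i0 := h ▸ adjEig_antitone _ (Fin.mk_le_of_le_val (Nat.zero_le _))
      have h1 : ∑ j ∈ Finset.univ.erase i0, (-1 : ℝ) < ∑ j ∈ Finset.univ.erase i0, f j :=
        Finset.sum_lt_sum (fun j _ => hge j)
          ⟨j, by simp [hj], by rw [hf, h]; linarith⟩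
      rw [Finset.sum_const, nsmul_eq_mul, hcard] at h1
      linarith
    · exact h
  split_ifs with h
  · have hj : j = i0 := Fin.ext h
    have h1 : ∑ j ∈ Finset.univ.erase i0, f j = ∑ j ∈ Finset.univ.erase i0, (-1 : ℝ) :=
      Finset.sum_congr rfl fun j hj => hne j (Finset.ne_of_mem_erase hj)
    rw [Finset.sum_const, nsmul_eq_mul, hcard] at h1
    rw [hj]
    linarith
  · exact hne j fun hj => h (by rw [hj])

theorem regularBound_top {n : ℕ} (hn : 2 ≤ n) (d : ℝ) :
    regularBound (⊤ : SimpleGraph (Fin n)) hn d (n - 1) = n * (d / ((n : ℝ) - 1)) := by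
  have h : n - 1 ≠ 0 := by omega
  have hn' : (2 : ℝ) ≤ n := by exact_mod_cast hn
  simp only [regularBound, adjEig_top hn, h, one_ne_zero, if_false]
  rw [Nat.cast_sub (by omega)]
  norm_num
  ring

/-! ### Derivatives of the field; kernel and range of the linearization at the origin. -/

theorem Dx_opinionField_top {n : ℕ} (d : ℝ) (x : E n) (u : ℝ) (v : E n) (i : Fin n) :
    Dx (opinionField (⊤ : SimpleGraph (Fin n)) d) x u v i
      = -(d * v i) + u * (∑ j, (1 - Real.tanh (x j) ^ 2) * v j
          - (1 - Real.tanh (x i) ^ 2) * v i) := by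
  have hp : ∀ j, HasFDerivAt (fun y : E n => y j) (EuclideanSpace.proj j : E n →L[ℝ] ℝ) x :=
    fun j => (EuclideanSpace.proj j : E n →L[ℝ] ℝ).hasFDerivAt
  have ht : ∀ j, HasFDerivAt (fun y : E n => Real.tanh (y j))
      ((1 - Real.tanh (x j) ^ 2) • (EuclideanSpace.proj j : E n →L[ℝ] ℝ)) x :=
    fun j => HasDerivAt.comp_hasFDerivAt (f := fun y : E n => y j) x (hasDerivAt_tanh (x j)) (hp j)
  have hcoord : ∀ i, HasFDerivAt (fun y : E n => opinionField (⊤ : SimpleGraph (Fin n)) d y u i)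
      (-(d • (EuclideanSpace.proj i : E n →L[ℝ] ℝ)) +
        u • (∑ j, (1 - Real.tanh (x j) ^ 2) • (EuclideanSpace.proj j : E n →L[ℝ] ℝ)
          - (1 - Real.tanh (x i) ^ 2) • (EuclideanSpace.proj i : E n →L[ℝ] ℝ))) x := by
    intro i
    simp only [opinionField_top_apply]
    exact (((hp i).const_mul d).neg).add
      (((HasFDerivAt.fun_sum fun j _ => ht j).sub (ht i)).const_mul u)
  have hd : DifferentiableAt ℝ (fun y : E n => opinionField (⊤ : SimpleGraph (Fin n)) d y u) x :=
    differentiableAt_euclidean.mpr fun i => (hcoord i).differentiableAt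
  have h := ((EuclideanSpace.proj i : E n →L[ℝ] ℝ).hasFDerivAt.comp x hd.hasFDerivAt).unique
    (hcoord i)
  have := DFunLike.congr_fun h v
  simpa [Dx] using this

theorem Dp_opinionField_top {n : ℕ} (d : ℝ) (x : E n) (u v : ℝ) (i : Fin n) :
    Dp (opinionField (⊤ : SimpleGraph (Fin n)) d) x u v i
      = v * (∑ j, Real.tanh (x j) - Real.tanh (x i)) := by
  have h : HasFDerivAt (fun p => opinionField (⊤ : SimpleGraph (Fin n)) d x p)
      ((ContinuousLinearMap.id ℝ ℝ).smulRight (WithLp.toLp 2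
        (((⊤ : SimpleGraph (Fin n)).adjMatrix ℝ).mulVec fun i => Real.tanh (x i)))) u :=
    ((hasFDerivAt_id u).smul_const _).const_add _
  rw [Dp, h.fderiv, ← mulVec_adjMatrix_top fun j => Real.tanh (x j)]
  rfl

/-- The all-ones vector. -/
def ones (n : ℕ) : E n := WithLp.toLp 2 fun _ => 1

theorem inner_ones {n : ℕ} (v : E n) : inner ℝ (ones n) v = ∑ i, v i := by
  simp [ones, PiLp.inner_apply]

theorem mem_span_ones_iff {n : ℕ} {v : E n} :
    v ∈ Submodule.span ℝ {ones n} ↔ ∃ c, ∀ i, v i = c := by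
  rw [Submodule.mem_span_singleton]
  refine exists_congr fun c => ⟨fun h i => ?_, fun h => ?_⟩
  · simp [← h, ones]
  · ext i
    simp [ones, h]

theorem mem_orthogonal_ones_iff {n : ℕ} {v : E n} :
    v ∈ (Submodule.span ℝ {ones n})ᗮ ↔ ∑ i, v i = 0 := by
  rw [Submodule.mem_orthogonal_singleton_iff_inner_right, inner_ones]

theorem Dx_opinionField_top_zero {n : ℕ} (d u : ℝ) (v : E n) (i : Fin n) :
    Dx (opinionField (⊤ : SimpleGraph (Fin n)) d) 0 u v i
      = -(d * v i) + u * (∑ j, v j - v i) := by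
  simp [Dx_opinionField_top]

variable {n : ℕ} {d us : ℝ}

theorem ker_Dx_zero (hn : 2 ≤ n) (hd : 0 < d) (hus : us = d / ((n : ℝ) - 1)) :
    LinearMap.ker (Dx (opinionField (⊤ : SimpleGraph (Fin n)) d) 0 us).toLinearMap
      = Submodule.span ℝ {ones n} := by
  have hn' : (0 : ℝ) < n - 1 := by
    have : (2 : ℝ) ≤ n := by exact_mod_cast hn
    linarith
  have hpos : 0 < us := hus ▸ div_pos hd hn'
  have hde : d = us * (n - 1) := by rw [hus]; field_simp
  ext v
  rw [LinearMap.mem_ker, mem_span_ones_iff]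
  constructor
  · intro h
    refine ⟨(∑ j, v j) / n, fun i => ?_⟩
    have hi : Dx (opinionField (⊤ : SimpleGraph (Fin n)) d) 0 us v i = 0 :=
      congrArg (fun w : E n => w i) h
    rw [Dx_opinionField_top_zero, hde] at hi
    rw [eq_div_iff (by linarith)]
    have : us * (∑ j, v j - v i * n) = 0 := by linarith
    rcases mul_eq_zero.mp this with h | h <;> linarith
  · rintro ⟨c, hc⟩
    ext i
    change Dx (opinionField (⊤ : SimpleGraph (Fin n)) d) 0 us v i = 0
    rw [Dx_opinionField_top_zero]
    simp only [hc, Finset.sum_const, Finset.card_univ, Fintype.card_fin, nsmul_eq_mul]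
    rw [hde]
    ring

theorem Dx_zero_eq_smul (hn : 2 ≤ n) (hus : us = d / ((n : ℝ) - 1)) {v : E n}
    (hv : ∑ i, v i = 0) :
    Dx (opinionField (⊤ : SimpleGraph (Fin n)) d) 0 us v = (-(n * us)) • v := by
  have hn' : (0 : ℝ) < n - 1 := by
    have : (2 : ℝ) ≤ n := by exact_mod_cast hn
    linarith
  have hde : d = us * (n - 1) := by rw [hus]; field_simp
  ext i
  rw [Dx_opinionField_top_zero, hv, PiLp.smul_apply, smul_eq_mul, hde]
  ring

theorem range_Dx_zero (hn : 2 ≤ n) (hd : 0 < d) (hus : us = d / ((n : ℝ) - 1)) :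
    LinearMap.range (Dx (opinionField (⊤ : SimpleGraph (Fin n)) d) 0 us).toLinearMap
      = (Submodule.span ℝ {ones n})ᗮ := by
  have hn' : (0 : ℝ) < n - 1 := by
    have : (2 : ℝ) ≤ n := by exact_mod_cast hn
    linarith
  have hpos : 0 < us := hus ▸ div_pos hd hn'
  have hde : d = us * (n - 1) := by rw [hus]; field_simp
  ext v
  rw [mem_orthogonal_ones_iff]
  constructor
  · rintro ⟨w, rfl⟩
    change ∑ i, Dx (opinionField (⊤ : SimpleGraph (Fin n)) d) 0 us w i = 0
    simp only [Dx_opinionField_top_zero]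
    rw [Finset.sum_add_distrib, Finset.sum_neg_distrib, ← Finset.mul_sum, ← Finset.mul_sum,
      Finset.sum_sub_distrib]
    simp only [Finset.sum_const, Finset.card_univ, Fintype.card_fin, nsmul_eq_mul]
    rw [hde]
    ring
  · intro hv
    refine ⟨(-(n * us))⁻¹ • v, ?_⟩
    change Dx (opinionField (⊤ : SimpleGraph (Fin n)) d) 0 us ((-(n * us))⁻¹ • v) = v
    rw [map_smul, Dx_zero_eq_smul hn hus hv, inv_smul_smul₀]
    have : (0 : ℝ) < n := by linarith
    exact neg_ne_zero.mpr (mul_pos this hpos).ne'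

/-- The derivative is `d tanh² + (d + u)(1 - tanh²)`, a convex combination of two positive numbers.
-/
theorem strictMono_mul_add_mul_tanh {d u : ℝ} (hd : 0 < d) (hu : -d < u) :
    StrictMono fun t => d * t + u * Real.tanh t := by
  apply strictMono_of_deriv_pos
  intro t
  have h : HasDerivAt (fun t => d * t + u * Real.tanh t)
      (d * 1 + u * (1 - Real.tanh t ^ 2)) t :=
    ((hasDerivAt_id t).const_mul d).add ((hasDerivAt_tanh t).const_mul u)
  rw [h.deriv]
  have h1 := Real.tanh_sq_lt_one t
  nlinarith [sq_nonneg (Real.tanh t), mul_pos (sub_pos.mpr h1) (sub_pos.mpr hu)]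

end CompleteGraph

namespace Frame

/-! ### The projection `Wᵀ` and the parameter ball for an arbitrary frame. -/

section General

variable {n q r : ℕ} {J : E n →L[ℝ] E n} (F : Frame J q r)

theorem inner_Wt (v : E n) (w : E r) : inner ℝ (F.Wt v) w = inner ℝ v (F.W w) :=
  ContinuousLinearMap.adjoint_inner_left _ _ _

theorem Wt_W (w : E r) : F.Wt (F.W w) = w := by
  refine ext_inner_right ℝ fun z => ?_
  rw [F.inner_Wt, F.W.inner_map_map]

theorem norm_Wt_le (v : E n) : ‖F.Wt v‖ ≤ ‖v‖ := by
  have h : ‖F.Wt‖ ≤ 1 := by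
    rw [Wt, ContinuousLinearMap.adjoint.norm_map]
    exact F.W.norm_toContinuousLinearMap_le
  simpa using F.Wt.le_of_opNorm_le h v

theorem norm_Wt_of_mem_range {v : E n} (hv : v ∈ LinearMap.range J.toLinearMap) :
    ‖F.Wt v‖ = ‖v‖ := by
  rw [← F.range_W] at hv
  obtain ⟨w, rfl⟩ := hv
  change ‖F.Wt (F.W w)‖ = ‖F.W w‖
  rw [F.Wt_W, F.W.norm_map]

theorem Wt_eq_zero_iff {v : E n} : F.Wt v = 0 ↔ v ∈ (LinearMap.range J.toLinearMap)ᗮ := by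
  rw [← F.range_W, Submodule.mem_orthogonal']
  constructor
  · rintro h _ ⟨w, rfl⟩
    change inner ℝ v (F.W w) = 0
    rw [← F.inner_Wt, h, inner_zero_left]
  · intro h
    refine ext_inner_right ℝ fun w => ?_
    rw [F.inner_Wt, inner_zero_left]
    exact h _ ⟨w, rfl⟩

theorem abs_sub_lt_of_mem_ballPar {ps R : ℝ} {z : WithLp 2 (E q × ℝ)}
    (hz : z ∈ F.ballPar 0 ps R) : |z.snd - ps| < R := by
  rw [ballPar, Metric.mem_ball, dist_eq_norm] at hz
  refine lt_of_le_of_lt ?_ hz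
  have h := WithLp.norm_snd_le (p := 2) (x := z - WithLp.toLp 2 (F.Vt 0, ps))
  simpa using h

theorem mem_ballPar_iff_zero_snd {ps R u : ℝ} :
    WithLp.toLp 2 ((0 : E q), u) ∈ F.ballPar 0 ps R ↔ |u - ps| < R := by
  rw [ballPar, Metric.mem_ball, dist_eq_norm, WithLp.prod_norm_eq_of_L2]
  simp [Real.sqrt_sq_eq_abs]

end General

/-! ### The constants of the reduction, the validity criterion and the implicit map. -/

section CompleteGraph

variable {n : ℕ} {d us : ℝ} (hn : 2 ≤ n) (hd : 0 < d) (hus : us = d / ((n : ℝ) - 1))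
  (F : Frame (Dx (opinionField (⊤ : SimpleGraph (Fin n)) d) 0 us) 1 (n - 1))

include hn hd hus

theorem Wt_eq_zero_iff_const {v : E n} : F.Wt v = 0 ↔ ∃ c, ∀ i, v i = c := by
  rw [F.Wt_eq_zero_iff, range_Dx_zero hn hd hus, Submodule.orthogonal_orthogonal,
    mem_span_ones_iff]

theorem V_const (a : E 1) : ∃ c, ∀ i, F.V a i = c := by
  rw [← mem_span_ones_iff, ← ker_Dx_zero hn hd hus, ← F.range_V]
  exact ⟨a, rfl⟩

theorem sum_Vbar (b : E (n - 1)) : ∑ i, F.Vbar b i = 0 := by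
  rw [← mem_orthogonal_ones_iff, ← ker_Dx_zero hn hd hus, ← F.range_Vbar]
  exact ⟨b, rfl⟩

theorem norm_Wt_Vbar (b : E (n - 1)) : ‖F.Wt (F.Vbar b)‖ = ‖b‖ := by
  rw [F.norm_Wt_of_mem_range, F.Vbar.norm_map]
  rw [range_Dx_zero hn hd hus, mem_orthogonal_ones_iff]
  exact F.sum_Vbar hn hd hus b

theorem Mpar_eq_zero : F.Mpar (opinionField (⊤ : SimpleGraph (Fin n)) d) 0 us = 0 := by
  rw [Mpar, norm_eq_zero]
  ext1 z
  change F.Wt (Dp _ 0 us z.snd) = 0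
  rw [F.Wt_eq_zero_iff_const hn hd hus]
  exact ⟨0, fun i => by simp [Dp_opinionField_top]⟩

/-- At a consensus point both partial derivatives, the first one applied to consensus vectors, are
again constant vectors. -/
theorem xiPar_eq_zero (a : E 1) (u : ℝ) :
    F.xiPar (opinionField (⊤ : SimpleGraph (Fin n)) d) 0 us a u = 0 := by
  obtain ⟨c, hc⟩ := F.V_const hn hd hus a
  ext1 z
  obtain ⟨c', hc'⟩ := F.V_const hn hd hus z.fst
  have hz : F.xiPar (opinionField (⊤ : SimpleGraph (Fin n)) d) 0 us a u z
      = F.Wt (Dx (opinionField (⊤ : SimpleGraph (Fin n)) d) (F.Γ a (F.VbarT 0)) u (F.V z.fst)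
        + (Dp (opinionField (⊤ : SimpleGraph (Fin n)) d) (F.Γ a (F.VbarT 0)) u z.snd
          - Dp (opinionField (⊤ : SimpleGraph (Fin n)) d) 0 us z.snd)) := rfl
  rw [hz, zero_apply]
  rw [F.Wt_eq_zero_iff_const hn hd hus]
  refine ⟨-(d * c') + u * (∑ _j : Fin n, (1 - Real.tanh c ^ 2) * c' - (1 - Real.tanh c ^ 2) * c')
    + z.snd * (∑ _j : Fin n, Real.tanh c - Real.tanh c), fun i => ?_⟩
  have hΓ : ∀ j, F.Γ a (F.VbarT 0) j = c := fun j => by simp [Γ, hc]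
  rw [PiLp.add_apply, PiLp.sub_apply, Dx_opinionField_top, Dp_opinionField_top,
    Dp_opinionField_top]
  simp only [hΓ, hc', PiLp.zero_apply, Real.tanh_zero, Finset.sum_const_zero, sub_zero, mul_zero]

theorem normsPar_subset (R : ℝ) :
    F.normsPar (opinionField (⊤ : SimpleGraph (Fin n)) d) 0 us R ⊆ {0} := by
  rintro t ⟨z, -, rfl⟩
  simp [F.xiPar_eq_zero hn hd hus]

theorem Lpar_eq_zero (R : ℝ) :
    F.Lpar (opinionField (⊤ : SimpleGraph (Fin n)) d) 0 us R = 0 := by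
  -- The set is empty when the ball is; `sSup ∅ = 0` covers that case.
  rcases Set.subset_singleton_iff_eq.mp (F.normsPar_subset hn hd hus R) with h | h <;>
    simp [Lpar, h]

theorem Mperp_eq : F.Mperp (opinionField (⊤ : SimpleGraph (Fin n)) d) 0 us = (n * us)⁻¹ := by
  have hn' : (2 : ℝ) ≤ n := by exact_mod_cast hn
  have hus0 : 0 < us := hus ▸ div_pos hd (by linarith)
  have hpos : 0 < n * us := mul_pos (by linarith) hus0
  -- The norm of a homothety equals its ratio only on a nontrivial space.
  have : Nonempty (Fin (n - 1)) := ⟨⟨0, by omega⟩⟩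
  set T := F.Wt ∘L Dx (opinionField (⊤ : SimpleGraph (Fin n)) d) 0 us ∘L
    F.Vbar.toContinuousLinearMap with hT
  have hnorm : ∀ b, ‖T b‖ = n * us * ‖b‖ := fun b => by
    change ‖F.Wt (Dx _ 0 us (F.Vbar b))‖ = _
    rw [Dx_zero_eq_smul hn hus (F.sum_Vbar hn hd hus b), map_smul, norm_smul,
      F.norm_Wt_Vbar hn hd hus, norm_neg, Real.norm_of_nonneg hpos.le]
  have hinj : Function.Injective T.toLinearMap := by
    rw [← LinearMap.ker_eq_bot, LinearMap.ker_eq_bot']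
    intro b hb
    have h := hnorm b
    rw [show T b = 0 from hb, norm_zero, eq_comm, mul_eq_zero] at h
    exact norm_eq_zero.mp (h.resolve_left hpos.ne')
  -- `ContinuousLinearMap.inverse` is zero off the invertible maps, so an actual equivalence is
  -- needed.
  let e : E (n - 1) ≃L[ℝ] E (n - 1) :=
    (LinearEquiv.ofInjectiveEndo T.toLinearMap hinj).toContinuousLinearEquiv
  have he : T = (e : E (n - 1) →L[ℝ] E (n - 1)) := by
    ext1 b
    rfl
  rw [Mperp, ← hT, he, ContinuousLinearMap.inverse_equiv]
  refine ContinuousLinearMap.homothety_norm _ fun y => ?_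
  have h := hnorm (e.symm y)
  rw [he, ContinuousLinearEquiv.coe_coe, e.apply_symm_apply] at h
  rw [h, inv_mul_cancel_left₀ hpos.ne']
  rfl

/-- The `d` terms cancel in the difference and the coupling sum is constant, so modulo `ker Wᵀ` only
a diagonal matrix remains. -/
theorem xiPerp_apply (a : E 1) (b b' : E (n - 1)) (u : ℝ) :
    F.xiPerp (opinionField (⊤ : SimpleGraph (Fin n)) d) 0 us a b u b'
      = -F.Wt (WithLp.toLp 2 fun i =>
          (u * (1 - Real.tanh (F.Γ a b i) ^ 2) - us) * F.Vbar b' i) := by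
  rw [← sub_eq_zero, sub_neg_eq_add]
  change F.Wt (Dx _ (F.Γ a b) u (F.Vbar b') - Dx _ 0 us (F.Vbar b')) + _ = 0
  rw [← map_add, F.Wt_eq_zero_iff_const hn hd hus]
  refine ⟨u * ∑ j, (1 - Real.tanh (F.Γ a b j) ^ 2) * F.Vbar b' j, fun i => ?_⟩
  rw [PiLp.add_apply, PiLp.sub_apply, Dx_opinionField_top, Dx_opinionField_top_zero,
    F.sum_Vbar hn hd hus]
  ring

theorem norm_xiPerp_le (a : E 1) (b : E (n - 1)) (u : ℝ) :
    ‖F.xiPerp (opinionField (⊤ : SimpleGraph (Fin n)) d) 0 us a b u‖ ≤ max us |u - us| := by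
  have hn' : (2 : ℝ) ≤ n := by exact_mod_cast hn
  have hus0 : 0 < us := hus ▸ div_pos hd (by linarith)
  have hM : 0 ≤ max us |u - us| := le_max_of_le_left hus0.le
  refine ContinuousLinearMap.opNorm_le_bound _ hM fun b' => ?_
  rw [F.xiPerp_apply hn hd hus, norm_neg]
  refine (F.norm_Wt_le _).trans ?_
  rw [← F.Vbar.norm_map b', ← Real.norm_of_nonneg hM, ← norm_smul]
  rw [EuclideanSpace.norm_eq, EuclideanSpace.norm_eq]
  refine Real.sqrt_le_sqrt (Finset.sum_le_sum fun i _ => ?_)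
  rw [PiLp.smul_apply, smul_eq_mul, norm_mul, norm_mul, Real.norm_of_nonneg hM]
  gcongr
  rw [Real.norm_eq_abs]
  have h1 := Real.tanh_sq_lt_one (F.Γ a b i)
  have h0 := sq_nonneg (Real.tanh (F.Γ a b i))
  have h2 := le_max_left us |u - us|
  have h3 := (le_abs_self (u - us)).trans (le_max_right us |u - us|)
  have h4 := (neg_le_abs (u - us)).trans (le_max_right us |u - us|)
  -- With `1 - tanh² ∈ (0, 1]`, the diagonal entry lies between `-us` and `u - us`.
  rw [abs_le]
  rcases le_total 0 u with hu | hu <;> constructor <;> nlinarith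

theorem norm_xiPerp_zero (u : ℝ) :
    ‖F.xiPerp (opinionField (⊤ : SimpleGraph (Fin n)) d) 0 us 0 0 u‖ = |u - us| := by
  have : Nonempty (Fin (n - 1)) := ⟨⟨0, by omega⟩⟩
  refine ContinuousLinearMap.homothety_norm _ fun b => ?_
  rw [F.xiPerp_apply hn hd hus, norm_neg]
  have h : (WithLp.toLp 2 fun i => (u * (1 - Real.tanh (F.Γ 0 0 i) ^ 2) - us) * F.Vbar b i)
      = (u - us) • F.Vbar b := by
    ext i
    simp [Γ]
  rw [h, map_smul, norm_smul, F.norm_Wt_Vbar hn hd hus, Real.norm_eq_abs]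

theorem withinBounds_iff (Rpar Rperp : ℝ) :
    F.WithinBounds (opinionField (⊤ : SimpleGraph (Fin n)) d) 0 us Rpar Rperp ↔
      0 < Rpar ∧ Rpar < n * us ∧ 0 < Rperp := by
  have hn' : (2 : ℝ) ≤ n := by exact_mod_cast hn
  have hus0 : 0 < us := hus ▸ div_pos hd (by linarith)
  have hpos : 0 < n * us := mul_pos (by linarith) hus0
  have hub : ∀ t ∈ F.normsPerp (opinionField (⊤ : SimpleGraph (Fin n)) d) 0 us Rpar Rperp,
      t ≤ max us Rpar := by
    rintro t ⟨z, hz, b, -, rfl⟩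
    exact (F.norm_xiPerp_le hn hd hus _ _ _).trans
      (max_le_max le_rfl (F.abs_sub_lt_of_mem_ballPar hz).le)
  constructor
  · intro h
    refine ⟨h.par_pos, ?_, h.perp_pos⟩
    have hL := h.contraction
    rw [F.Mperp_eq hn hd hus, inv_mul_lt_iff₀ hpos, mul_one] at hL
    -- The ball is open, so `Rpar ≤ L_⊥` is obtained from every `s < Rpar`, tested at the origin
    -- with `u = us + s`.
    refine lt_of_le_of_lt (le_of_forall_lt_imp_le_of_dense fun s hs => ?_) hL
    rcases lt_or_ge s 0 with hs0 | hs0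
    · exact hs0.le.trans (Real.sSup_nonneg fun t ⟨_, _, _, _, ht⟩ => ht ▸ norm_nonneg _)
    · refine le_csSup h.bdd_perp ⟨WithLp.toLp 2 (0, us + s), ?_, 0, ?_, ?_⟩
      · rw [F.mem_ballPar_iff_zero_snd]
        simpa [abs_of_nonneg hs0] using hs
      · simpa [ballPerp] using h.perp_pos
      · change s = ‖F.xiPerp _ 0 us 0 0 (us + s)‖
        rw [F.norm_xiPerp_zero hn hd hus, add_sub_cancel_left, abs_of_nonneg hs0]
  · rintro ⟨h1, h2, h3⟩
    have hL : F.Lperp (opinionField (⊤ : SimpleGraph (Fin n)) d) 0 us Rpar Rperp < n * us := by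
      refine lt_of_le_of_lt (Real.sSup_le hub (le_max_of_le_left hus0.le)) (max_lt ?_ h2)
      nlinarith
    refine ⟨h1, h3, BddAbove.mono (F.normsPar_subset hn hd hus Rpar) bddAbove_singleton,
      ⟨_, hub⟩, ?_, ?_⟩
    · rw [F.Lpar_eq_zero hn hd hus, F.Mpar_eq_zero hn hd hus, F.Mperp_eq hn hd hus, div_inv_eq_mul,
        zero_mul, zero_add, sub_zero, mul_comm Rperp]
      exact mul_lt_mul_of_pos_right hL h3
    · rwa [F.Mperp_eq hn hd hus, inv_mul_lt_iff₀ hpos, mul_one]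

/-- The opinion field maps the consensus space `ker J` into itself, so the reduced equation is
solved by `β = 0`; strict monotonicity of `t ↦ d t + u tanh t` for `u > -d` excludes any other
solution. -/
theorem Wt_opinionField_eq_zero_iff {u : ℝ} (hu : -d < u) (a : E 1) (b : E (n - 1)) :
    F.Wt (opinionField (⊤ : SimpleGraph (Fin n)) d (F.Γ a b) u) = 0 ↔ b = 0 := by
  obtain ⟨c, hc⟩ := F.V_const hn hd hus a
  rw [F.Wt_eq_zero_iff_const hn hd hus]
  simp only [opinionField_top_apply]
  constructor
  · rintro ⟨k, hk⟩
    have hx : ∀ i j, F.Γ a b i = F.Γ a b j := fun i j =>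
      (strictMono_mul_add_mul_tanh hd hu).injective (by
        have hi := hk i
        have hj := hk j
        simp only
        linarith)
    have hb : ∀ i j, F.Vbar b i = F.Vbar b j := fun i j => by
      have h := hx i j
      simpa only [Γ, PiLp.add_apply, hc, add_right_inj] using h
    have hs := F.sum_Vbar hn hd hus b
    have hz : F.Vbar b = 0 := by
      ext i
      rw [Finset.sum_congr rfl fun j _ => hb j i] at hs
      simp only [Finset.sum_const, Finset.card_univ, Fintype.card_fin, nsmul_eq_mul] at hs
      exact (mul_eq_zero.mp hs).resolve_left (by positivity)
    exact F.Vbar.injective (hz.trans (map_zero _).symm)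
  · rintro rfl
    exact ⟨-(d * c) + u * (∑ _j : Fin n, Real.tanh c - Real.tanh c), fun i => by
      simp only [Γ, map_zero, add_zero, hc]⟩

theorem isImplicitMap_zero {Rpar Rperp : ℝ} (h2 : Rpar < n * us) (h3 : 0 < Rperp) :
    F.IsImplicitMap (opinionField (⊤ : SimpleGraph (Fin n)) d) 0 us Rpar Rperp fun _ => 0 where
  mapsTo z _ := by simpa [ballPerp] using h3
  smooth := contDiffOn_const
  base := (map_zero _).symm
  solves z hz b _ := by
    refine F.Wt_opinionField_eq_zero_iff hn hd hus ?_ _ _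
    have hn' : (0 : ℝ) < n - 1 := by
      have : (2 : ℝ) ≤ n := by exact_mod_cast hn
      linarith
    have hde : d = us * (n - 1) := by rw [hus]; field_simp
    -- The radius is sharp here: `u > us - n * us = -d`.
    have := (abs_lt.mp (F.abs_sub_lt_of_mem_ballPar hz)).1
    rw [hde]
    linarith

end CompleteGraph

end Frame

end LyapunovSchmidt

open LyapunovSchmidt in
theorem mainTheorem5 (n : ℕ) (hn : 2 ≤ n) (d : ℝ) (hd : 0 < d)
    (us : ℝ) (hus : us = d / ((n : ℝ) - 1)) :
    (⊤ : SimpleGraph (Fin n)).IsRegularOfDegree (n - 1) ∧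
    (∀ j : Fin n, adjEig (⊤ : SimpleGraph (Fin n)) j = if j.val = 0 then (n : ℝ) - 1 else -1) ∧
    regularBound (⊤ : SimpleGraph (Fin n)) hn d (n - 1) = n * us ∧
    opinionField (⊤ : SimpleGraph (Fin n)) d 0 us = 0 ∧
    LinearMap.ker (Dx (opinionField (⊤ : SimpleGraph (Fin n)) d) 0 us).toLinearMap
      = Submodule.span ℝ {(WithLp.toLp 2 fun _ => 1 : E n)} ∧
    ∀ F : Frame (Dx (opinionField (⊤ : SimpleGraph (Fin n)) d) 0 us) 1 (n - 1),
      ∀ Rpar Rperp : ℝ,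
        (F.WithinBounds (opinionField (⊤ : SimpleGraph (Fin n)) d) 0 us Rpar Rperp ↔
          0 < Rpar ∧ Rpar < n * us ∧ 0 < Rperp) ∧
        (0 < Rpar ∧ Rpar < n * us ∧ 0 < Rperp →
          ∃ φ, F.IsImplicitMap (opinionField (⊤ : SimpleGraph (Fin n)) d) 0 us Rpar Rperp φ) := by
  refine ⟨?_, adjEig_top hn, ?_, ?_, ker_Dx_zero hn hd hus, fun F Rpar Rperp =>
    ⟨F.withinBounds_iff hn hd hus Rpar Rperp, fun h =>
      ⟨_, F.isImplicitMap_zero hn hd hus h.2.1 h.2.2⟩⟩⟩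
  · intro v
    rw [SimpleGraph.complete_graph_degree, Fintype.card_fin]
  · rw [regularBound_top, hus]
  · ext i
    simp [opinionField_top_apply]
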